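/- Throughout, rings are commutative with $1$. A topological ring $A$ is \emph{f-adic} if it has an open subring $A_0$ whose subspace topology is the $I$-adic topology for some finitely generated ideal $I$ of $A_0$ (neither completeness nor the Hausdorff property is assumed). A subset $B\subseteq A$ is bounded if for every neighbourhood $U$ of $0$ there is an open neighbourhood $V$ of $0$ with $vb\in U$ for all $v\in V$, $b\in B$; an element $x$ is power-bounded if $\{x^n : n\ge 1\}$ is bounded. An \emph{affinoid ring} is a pair $(A,A^+)$, where $A$ is an f-adic ring and $A^+\subseteq A$ is an open subring that is integrally closed in $A$ and consists of power-bounded elements. For a ring $A$, let $\operatorname{Spv} A$ be the set of equivalence classes of valuations $v\colon A\to\Gamma_v\cup\{0\}$ (of arbitrary rank, with value group $\Gamma_v$), with the topology generated by the sets $\{v : v(f)\le v(s)\ne 0\}$, $f,s\in A$. If $A$ is a topological ring, $v$ is called continuous if $\{a\in A : v(a)<\gamma\}$ is open in $A$ for all $\gamma\in\Gamma_v$. For an affinoid ring $(A,A^+)$ let $$\operatorname{Spa}(A,A^+)=\{v\in\operatorname{Spv}A : v \text{ is continuous and } v(f)\le 1 \text{ for all } f\in A^+\}$$ with the subspace topology.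 A \emph{rational subset} of $\operatorname{Spa}(A,A^+)$ is a set of the form $$R\left(\tfrac{T}{s}\right)=\{v\in\operatorname{Spa}(A,A^+) : v(t)\le v(s) \text{ for all } t\in T, \text{ and } v(s)\ne 0\},$$ where $s\in A$ and $T\subseteq A$ is a finite subset such that the ideal of $A$ generated by $T$ is open in $A$. \textbf{Theorem.} Let $(A,A^+)$ be an affinoid ring. Then: (1) $\operatorname{Spa}(A,A^+)$ is a spectral space, that is, it is quasi-compact and sober, and it has a basis of quasi-compact open subsets that is closed under finite intersections. (2) The rational subsets form a basis of the topology of $\operatorname{Spa}(A,A^+)$, every rational subset is open and quasi-compact, and the set of rational subsets is stable under finite intersections (including the empty one, i.e. the whole space is a rational subset). -/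

import Mathlib

open Topology TopologicalSpace

noncomputable section

/-! ### f-adic rings and affinoid rings -/

section AffinoidRings

variable {A : Type*} [CommRing A] [TopologicalSpace A]

/-- A pair of definition of a topological ring `A`: an open subring `A₀` whose subspace topology
is the `I`-adic topology for the finitely generated ideal `I` of `A₀`. -/
structure IsPairOfDefinition (A₀ : Subring A) (I : Ideal A₀) : Prop where
  isOpen : IsOpen (A₀ : Set A)
  fg : I.FG
  isAdic : IsAdic I

variable (A) in
/-- An f-adic ring (Huber ring): a topological ring that has a pair of definition. -/
structure IsFAdicRing : Prop where
  isTopologicalRing : IsTopologicalRing A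
  exists_pairOfDefinition : ∃ (A₀ : Subring A) (I : Ideal A₀), IsPairOfDefinition A₀ I

/-- A subset `B` of a topological ring is bounded if for every neighbourhood `U` of `0` there is
an open neighbourhood `V` of `0` with `v * b ∈ U` for all `v ∈ V` and `b ∈ B`. -/
def IsBoundedSubset (B : Set A) : Prop :=
  ∀ U ∈ 𝓝 (0 : A), ∃ V : Set A, IsOpen V ∧ 0 ∈ V ∧ ∀ v ∈ V, ∀ b ∈ B, v * b ∈ U

/-- An element is power-bounded if the set of its powers `x ^ n`, `n ≥ 1`, is bounded. -/
def IsPowerBoundedElement (x : A) : Prop :=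
  IsBoundedSubset {y : A | ∃ n : ℕ, 1 ≤ n ∧ y = x ^ n}

/-- A ring of integral elements: an open subring that is integrally closed in `A` and consists of
power-bounded elements. -/
structure IsRingOfIntegralElements (B : Subring A) : Prop where
  isOpen : IsOpen (B : Set A)
  mem_of_isIntegral : ∀ a : A, IsIntegral B a → a ∈ B
  isPowerBounded : ∀ b ∈ B, IsPowerBoundedElement b

/-- `(A, Aplus)` is an affinoid ring: `A` is f-adic and `Aplus` is a ring of integral elements. -/
structure IsAffinoidRing (Aplus : Subring A) : Prop where
  isFAdicRing : IsFAdicRing A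
  isRingOfIntegralElements : IsRingOfIntegralElements Aplus

end AffinoidRings

/-! ### The valuation spectrum -/

/-- The underlying set of the valuation spectrum of `A`. A point is an equivalence class of
valuations on `A`, encoded (as in Mathlib) by the relation `v a ≤ v b` that it induces on `A`;
see `Spv.eq_ofValuation_val` and `Spv.ofValuation_eq_ofValuation_iff`. -/
@[ext]
structure Spv (A : Type*) [CommRing A] where
  /-- The relation `v a ≤ v b`. -/
  rel : ValuativeRel A

namespace Spv

variable {A : Type*} [CommRing A]

/-- The value group of `v`, with `0` adjoined. -/
abbrev ValueGroup (v : Spv A) : Type _ := @ValuativeRel.ValueGroupWithZero A _ v.rel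

/-- The canonical representative of the equivalence class `v`; its values generate
the value group. -/
def val (v : Spv A) : Valuation A v.ValueGroup := @ValuativeRel.valuation A _ v.rel

/-- The equivalence class of a valuation. -/
def ofValuation {Γ : Type*} [LinearOrderedCommGroupWithZero Γ] (w : Valuation A Γ) : Spv A :=
  ⟨_root_.ValuativeRel.ofValuation w⟩

theorem val_le_val_iff (v : Spv A) (a b : A) : v.val a ≤ v.val b ↔ v.rel.vle a b :=
  letI := v.rel
  (Valuation.Compatible.vle_iff_le (v := ValuativeRel.valuation A) a b).symm

/-- The canonical representative of the class of `w` is equivalent to `w`. -/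
theorem val_ofValuation_isEquiv {Γ : Type*} [LinearOrderedCommGroupWithZero Γ] (w : Valuation A Γ) :
    (ofValuation w).val.IsEquiv w :=
  fun a b => val_le_val_iff (ofValuation w) a b

/-- Every point is the class of its canonical representative. -/
theorem eq_ofValuation_val (v : Spv A) : v = ofValuation v.val := by
  ext a b
  exact (val_le_val_iff v a b).symm

/-- Two valuations define the same point if and only if they are equivalent. -/
theorem ofValuation_eq_ofValuation_iff {Γ Γ' : Type*} [LinearOrderedCommGroupWithZero Γ]
    [LinearOrderedCommGroupWithZero Γ'] (w : Valuation A Γ) (w' : Valuation A Γ') :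
    ofValuation w = ofValuation w' ↔ w.IsEquiv w' := by
  constructor
  · intro h a b
    rw [← val_ofValuation_isEquiv w a b, ← val_ofValuation_isEquiv w' a b, h]
  · intro h
    ext a b
    exact h a b

/-- The topology of the valuation spectrum, generated by the sets `{v | v f ≤ v s ≠ 0}`. -/
instance : TopologicalSpace (Spv A) :=
  generateFrom {U | ∃ f s : A, U = {v : Spv A | v.val f ≤ v.val s ∧ v.val s ≠ 0}}

/-- A valuation is continuous if `{a | v a < γ}` is open for every `γ` in its value group. -/
def IsContinuous [TopologicalSpace A] (v : Spv A) : Prop :=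
  ∀ γ : v.ValueGroup, γ ≠ 0 → IsOpen {a : A | v.val a < γ}

end Spv

/-! ### The adic spectrum -/

section AdicSpectrum

variable {A : Type*} [CommRing A] [TopologicalSpace A]

variable (A) in
/-- The set of (equivalence classes of) continuous valuations on `A`. -/
def ContSpv : Set (Spv A) := {v | v.IsContinuous}

/-- The adic spectrum of `(A, Aplus)`. As a topological space it carries the subspace topology
of the valuation spectrum (the standard instance on the subtype). -/
def Spa (Aplus : Subring A) : Set (Spv A) := {v ∈ ContSpv A | ∀ f ∈ Aplus, v.val f ≤ 1}

/-- The set `R(T/s)` of all `v ∈ Spa (A, Aplus)` with `v t ≤ v s` for all `t ∈ T` and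
`v s ≠ 0`. -/
def rationalSet (Aplus : Subring A) (T : Finset A) (s : A) : Set (Spa Aplus) :=
  {v | (∀ t ∈ T, v.1.val t ≤ v.1.val s) ∧ v.1.val s ≠ 0}

/-- The rational subsets of the adic spectrum: the sets `R(T/s)` with `T` finite such that
the ideal of `A` generated by `T` is open in `A`. -/
def rationalSubsets (Aplus : Subring A) : Set (Set (Spa Aplus)) :=
  {U | ∃ (T : Finset A) (s : A), IsOpen (Ideal.span (T : Set A) : Set A) ∧
    U = rationalSet Aplus T s}

end AdicSpectrum

end

/-! The adic spectrum is the image of a compact space under a set-theoretic retraction. Fix a pair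
of definition `(A₀, I)`. The relations on `A` given by valuations with `v ≤ 1` on `Aplus` and `v <
1` on `I` form a closed, hence compact, subset of `A → A → Bool`. Every continuous valuation has `v
< 1` on `I`. Conversely, if `v < 1` on `I`, the topological support of `v` is a `v`-convex prime
ideal, and sending it to `0` makes `v` continuous (`Valuation.retract`).

The retraction respects the conditions defining `R(T/s)` when `T` generates an open ideal
(`Spv.retract_mem_rational_iff`). The reason is that an open topological support is already the
support (`Valuation.eq_zero_of_pow_subset_topologicalSupport`); finite generation of `I` enters
here. So rational subsets have clopen preimages in a compact space, and for a basis closed under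
finite intersections in a T0 space this forces spectrality (`spectralSpace_of_isClopen_preimage`).
-/

/-! ### A criterion for spectrality -/

section SpectralCriterion

variable {X K : Type*} [TopologicalSpace X] [TopologicalSpace K] [CompactSpace K]
  {B : Set (Set X)} {g : K → X}

theorem isCompact_of_isClopen_preimage (hB : IsTopologicalBasis B) (hg : Function.Surjective g)
    (hclopen : ∀ U ∈ B, IsClopen (g ⁻¹' U)) {U : Set X} (hU : U ∈ B) : IsCompact U := by
  have hcont : Continuous g := hB.continuous_iff.2 fun V hV => (hclopen V hV).isOpen
  rw [← Set.image_preimage_eq U hg]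
  exact (hclopen U hU).isClosed.isCompact.image hcont

/-- Irreducibility gives the basic open sets meeting `S` the finite intersection property within
`S`. Their preimages are closed, so compactness of `K` yields a point common to all of them; its
image is generic in `S`. -/
theorem quasiSober_of_isClopen_preimage (hB : IsTopologicalBasis B) (hg : Function.Surjective g)
    (hclopen : ∀ U ∈ B, IsClopen (g ⁻¹' U)) : QuasiSober X where
  sober := by
    intro S hS hSc
    have hcont : Continuous g := hB.continuous_iff.2 fun V hV => (hclopen V hV).isOpen
    let ι := {U : Set X // U ∈ B ∧ (S ∩ U).Nonempty}
    have key : ∀ u : Finset ι, (S ∩ ⋂ i ∈ u, i.1).Nonempty := by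
      intro u
      have := (isIrreducible_iff_sInter.1 hS) (u.image Subtype.val) ?_ ?_
      · simpa using this
      · intro U hU
        obtain ⟨i, -, rfl⟩ := Finset.mem_image.1 hU
        exact hB.isOpen i.2.1
      · intro U hU
        obtain ⟨i, -, rfl⟩ := Finset.mem_image.1 hU
        exact i.2.2
    obtain ⟨k, hkS, hk⟩ := (hSc.preimage hcont).isCompact.inter_iInter_nonempty
      (fun i : ι => g ⁻¹' i.1) (fun i => (hclopen i.1 i.2.1).isClosed) fun u => by
        obtain ⟨x, hx⟩ := key u
        obtain ⟨k, rfl⟩ := hg x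
        exact ⟨k, by simpa using hx⟩
    have hkS : g k ∈ S := hkS
    refine ⟨g k, (closure_minimal (Set.singleton_subset_iff.2 hkS) hSc).antisymm fun y hy => ?_⟩
    refine hB.mem_closure_iff.2 fun U hU hyU => ⟨g k, ?_, rfl⟩
    exact Set.mem_iInter.1 hk ⟨U, hU, y, hy, hyU⟩

theorem spectralSpace_of_isClopen_preimage [T0Space X] (hB : IsTopologicalBasis B)
    (hinter : FiniteInter B) (hg : Function.Surjective g)
    (hclopen : ∀ U ∈ B, IsClopen (g ⁻¹' U)) : SpectralSpace X := by
  have hcomp : ∀ U ∈ B, IsCompact U := fun U => isCompact_of_isClopen_preimage hB hg hclopen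
  have := PrespectralSpace.of_isTopologicalBasis hB hcomp
  have := quasiSober_of_isClopen_preimage hB hg hclopen
  have : CompactSpace X := ⟨hcomp _ hinter.univ_mem⟩
  have hB' : IsTopologicalBasis (Set.range ((↑) : B → Set X)) := by rwa [Subtype.range_coe]
  have := QuasiSeparatedSpace.of_isTopologicalBasis hB'
    fun U V => hcomp _ (hinter.inter_mem U.2 V.2)
  exact { }

end SpectralCriterion

/-! ### Pairs of definition -/

namespace IsPairOfDefinition

variable {A : Type*} [CommRing A] [TopologicalSpace A] {A₀ : Subring A} {I : Ideal A₀}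

theorem hasBasis_nhds_zero (h : IsPairOfDefinition A₀ I) :
    (𝓝 (0 : A)).HasBasis (fun _ : ℕ => True)
      fun n => Subtype.val '' ((I ^ n : Ideal A₀) : Set A₀) := by
  have hemb : IsOpenEmbedding (Subtype.val : A₀ → A) := h.isOpen.isOpenEmbedding_subtypeVal
  have := (h.isAdic.hasBasis_nhds_zero).map (Subtype.val : A₀ → A)
  rw [hemb.map_nhds_eq (0 : A₀)] at this
  exact this

theorem coe_pow_mem_nhds_zero (h : IsPairOfDefinition A₀ I) (n : ℕ) :
    Subtype.val '' ((I ^ n : Ideal A₀) : Set A₀) ∈ 𝓝 (0 : A) :=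
  h.hasBasis_nhds_zero.mem_of_mem trivial

theorem isOpen_ideal_iff [IsTopologicalRing A] (h : IsPairOfDefinition A₀ I) (J : Ideal A) :
    IsOpen (J : Set A) ↔ ∃ n : ℕ, ∀ x ∈ I ^ n, (x : A) ∈ J := by
  constructor
  · intro hJ
    obtain ⟨n, -, hn⟩ := h.hasBasis_nhds_zero.mem_iff.1 (hJ.mem_nhds J.zero_mem)
    exact ⟨n, fun x hx => hn ⟨x, hx, rfl⟩⟩
  · rintro ⟨n, hn⟩
    refine J.toAddSubgroup.isOpen_of_mem_nhds (g := 0)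
      (Filter.mem_of_superset (h.coe_pow_mem_nhds_zero n) ?_)
    rintro _ ⟨x, hx, rfl⟩
    exact hn x hx

theorem isOpen_ideal_mul [IsTopologicalRing A] (h : IsPairOfDefinition A₀ I) {J J' : Ideal A}
    (hJ : IsOpen (J : Set A)) (hJ' : IsOpen (J' : Set A)) : IsOpen ((J * J' : Ideal A) : Set A) := by
  obtain ⟨n, hn⟩ := (h.isOpen_ideal_iff J).1 hJ
  obtain ⟨m, hm⟩ := (h.isOpen_ideal_iff J').1 hJ'
  refine (h.isOpen_ideal_iff _).2 ⟨n + m, fun x hx => ?_⟩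
  rw [pow_add] at hx
  induction hx using Submodule.mul_induction_on' with
  | mem_mul_mem x hx y hy => exact Ideal.mul_mem_mul (hn x hx) (hm y hy)
  | add x _ y _ hx hy => exact add_mem hx hy

end IsPairOfDefinition

noncomputable section

/-! ### The topological support of a valuation -/

namespace Valuation

variable {A : Type*} [CommRing A] [TopologicalSpace A]
  {Γ : Type*} [LinearOrderedCommGroupWithZero Γ]

/-- The elements `a` such that `{x | v x < v a}` is not a neighbourhood of `0`. It contains the
support of `v`, with equality if and only if `v` is continuous. -/
def topologicalSupport (v : Valuation A Γ) : Set A := {a | {x | v x < v a} ∉ 𝓝 0}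

theorem notMem_topologicalSupport {v : Valuation A Γ} {a : A} :
    a ∉ v.topologicalSupport ↔ {x | v x < v a} ∈ 𝓝 0 := not_not

theorem mem_topologicalSupport_of_le {v : Valuation A Γ} {a b : A} (h : v a ≤ v b)
    (hb : b ∈ v.topologicalSupport) : a ∈ v.topologicalSupport :=
  fun ha => hb (Filter.mem_of_superset ha fun _ hx => lt_of_lt_of_le hx h)

theorem lt_of_mem_topologicalSupport {v : Valuation A Γ} {a b : A}
    (ha : a ∈ v.topologicalSupport) (hb : b ∉ v.topologicalSupport) : v a < v b :=
  not_le.1 fun h => hb (mem_topologicalSupport_of_le h ha)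

theorem mem_topologicalSupport_of_eq_zero {v : Valuation A Γ} {a : A} (h : v a = 0) :
    a ∈ v.topologicalSupport := fun ha => by
  simpa [h] using mem_of_mem_nhds ha

theorem add_mem_topologicalSupport {v : Valuation A Γ} {a b : A}
    (ha : a ∈ v.topologicalSupport) (hb : b ∈ v.topologicalSupport) :
    a + b ∈ v.topologicalSupport := by
  rcases le_max_iff.1 (v.map_add a b) with h | h
  · exact mem_topologicalSupport_of_le h ha
  · exact mem_topologicalSupport_of_le h hb

theorem setOf_map_mul_lt_mem_nhds_zero [IsTopologicalRing A] {v : Valuation A Γ} {a : A} (b : A)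
    (ha : a ∉ v.topologicalSupport) : {x | v (x * b) < v a} ∈ 𝓝 0 := by
  have hcont : Filter.Tendsto (fun x : A => x * b) (𝓝 0) (𝓝 0) := by
    simpa using (continuous_mul_const b).tendsto (0 : A)
  exact hcont (notMem_topologicalSupport.1 ha)

theorem mul_mem_topologicalSupport [IsTopologicalRing A] {v : Valuation A Γ} {a : A}
    (ha : a ∈ v.topologicalSupport) (b : A) : a * b ∈ v.topologicalSupport := by
  intro hab
  refine ha (Filter.mem_of_superset
    (setOf_map_mul_lt_mem_nhds_zero b (notMem_topologicalSupport.2 hab)) fun x hx => ?_)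
  simp only [Set.mem_ofPred_eq, map_mul] at hx ⊢
  exact lt_of_mul_lt_mul_right' hx

theorem ne_zero_of_notMem_topologicalSupport {v : Valuation A Γ} {a : A}
    (ha : a ∉ v.topologicalSupport) : v a ≠ 0 :=
  mt mem_topologicalSupport_of_eq_zero ha

theorem map_lt_of_mem_mul {A : Type*} [CommRing A] {A₀ : Subring A} {v : Valuation A Γ}
    {J J' : Ideal A₀} {γ : Γ}
    (h : ∀ x ∈ J, ∀ y ∈ J', v (x * y) < γ) : ∀ x ∈ J * J', v x < γ := by
  intro x hx
  induction hx using Submodule.mul_induction_on' with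
  | mem_mul_mem x hx y hy => simpa using h x hx y hy
  | add x _ y _ hx hy => exact v.map_add_lt hx hy

theorem notMem_topologicalSupport_iff_exists_pow {A₀ : Subring A} {I : Ideal A₀}
    {v : Valuation A Γ} (hI : IsPairOfDefinition A₀ I) {a : A} :
    a ∉ v.topologicalSupport ↔ ∃ n : ℕ, ∀ x ∈ I ^ n, v x < v a := by
  rw [notMem_topologicalSupport, hI.hasBasis_nhds_zero.mem_iff]
  simp [Set.subset_def]

/-! ### Primality of the topological support for valuations with `v < 1` on `I`. -/

section Pair

variable {A₀ : Subring A} {I : Ideal A₀} {v : Valuation A Γ}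

theorem one_notMem_topologicalSupport (hI : IsPairOfDefinition A₀ I) (hv : ∀ x ∈ I, v x < 1) :
    (1 : A) ∉ v.topologicalSupport :=
  (notMem_topologicalSupport_iff_exists_pow hI).2 ⟨1, by simpa using hv⟩

theorem mul_notMem_topologicalSupport (hI : IsPairOfDefinition A₀ I) {a b : A}
    (ha : a ∉ v.topologicalSupport) (hb : b ∉ v.topologicalSupport) :
    a * b ∉ v.topologicalSupport := by
  obtain ⟨n, hn⟩ := (notMem_topologicalSupport_iff_exists_pow hI).1 ha
  obtain ⟨m, hm⟩ := (notMem_topologicalSupport_iff_exists_pow hI).1 hb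
  refine (notMem_topologicalSupport_iff_exists_pow hI).2 ⟨n + m, ?_⟩
  rw [pow_add]
  refine map_lt_of_mem_mul fun x hx y hy => ?_
  rw [map_mul, map_mul]
  exact mul_lt_mul'' (hn x hx) (hm y hy) zero_le zero_le

theorem mem_topologicalSupport_of_pow_mem (hI : IsPairOfDefinition A₀ I) (hv : ∀ x ∈ I, v x < 1)
    {a : A} {n : ℕ} (h : a ^ n ∈ v.topologicalSupport) : a ∈ v.topologicalSupport := by
  by_contra ha
  induction n with
  | zero => exact one_notMem_topologicalSupport hI hv (by simpa using h)
  | succ n ih => exact ih (by_contra fun hn => by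
      rw [pow_succ] at h
      exact mul_notMem_topologicalSupport hI hn ha h)

/-- If the topological support is open, then it is the support. -/
theorem eq_zero_of_pow_subset_topologicalSupport (hI : IsPairOfDefinition A₀ I)
    (hv : ∀ x ∈ I, v x < 1) {n : ℕ} (hn : ∀ x ∈ I ^ n, (x : A) ∈ v.topologicalSupport) :
    ∀ a ∈ v.topologicalSupport, v a = 0 := by
  obtain ⟨T, hT⟩ := hI.fg
  have hTI : ∀ t ∈ T, t ∈ I := fun t ht => hT ▸ Ideal.subset_span ht
  have hTsupp : ∀ t ∈ T, (t : A) ∈ v.topologicalSupport := fun t ht =>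
    mem_topologicalSupport_of_pow_mem hI hv (n := n)
      (by simpa using hn _ (Ideal.pow_mem_pow (hTI t ht) n))
  have hT0 : ∀ t ∈ T, v (t : A) = 0 := by
    -- If the largest value `v t` on the generators were nonzero, then `v < v t` on `I ^ 2`,
    -- contradicting that `t` lies in the topological support.
    rcases T.eq_empty_or_nonempty with rfl | hne
    · simp
    obtain ⟨t, ht, hmax⟩ := T.exists_max_image (fun t => v (t : A)) hne
    suffices v (t : A) = 0 from fun t' ht' => le_zero_iff.1 (this ▸ hmax t' ht')
    by_contra ht0
    refine (notMem_topologicalSupport_iff_exists_pow hI).2 ⟨2, ?_⟩ (hTsupp t ht)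
    rw [pow_two]
    refine map_lt_of_mem_mul fun x hx y hy => ?_
    -- Here `x` varies inside the induction on `y`, so that coefficients of `y`, on which `v` may
    -- exceed `1`, are absorbed into `x ∈ I`.
    have key : ∀ y ∈ I, ∀ x ∈ I, v ((x : A) * y) < v (t : A) := by
      intro y hy
      rw [← hT] at hy
      induction hy using Submodule.span_induction with
      | mem y hy =>
        intro x hx
        rw [map_mul]
        calc v (x : A) * v (y : A) ≤ v (x : A) * v (t : A) := by gcongr; exact hmax y hy
          _ < 1 * v (t : A) := mul_lt_mul_of_pos_right (hv x hx) (zero_lt_iff.2 ht0)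
          _ = v (t : A) := one_mul _
      | zero => intro x _; simpa using zero_lt_iff.2 ht0
      | add y z _ _ hy hz =>
        intro x hx
        simpa [mul_add] using v.map_add_lt (hy x hx) (hz x hx)
      | smul c y _ hy =>
        intro x hx
        simpa [mul_assoc] using hy (x * c) (I.mul_mem_right c hx)
    exact key y hy x hx
  have hI0 : ∀ x ∈ I, v (x : A) = 0 := by
    intro x hx
    rw [← hT] at hx
    induction hx using Submodule.span_induction with
    | mem x hx => exact hT0 x hx
    | zero => simp
    | add x y _ _ hx hy =>
      exact le_zero_iff.1 ((v.map_add _ _).trans (by simp [hx, hy]))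
    | smul c x _ hx => simp [hx]
  intro a ha
  by_contra ha0
  refine (notMem_topologicalSupport_iff_exists_pow hI).2 ⟨1, fun x hx => ?_⟩ ha
  rw [hI0 x (by simpa using hx)]
  exact zero_lt_iff.2 ha0

variable [IsTopologicalRing A] in
/-- The class of the valuation obtained from `v` by sending the topological support to `0`. -/
def retract (v : Valuation A Γ) (hI : IsPairOfDefinition A₀ I) (hv : ∀ x ∈ I, v x < 1) :
    Spv A := Spv.mk {
  -- The axioms survive because the topological support is a convex prime ideal; primality is what
  -- cancellation needs.
  vle a b := v a ≤ v b ∨ a ∈ v.topologicalSupport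
  vle_total a b := (le_total (v a) (v b)).imp .inl .inl
  vle_trans := by
    rintro z y x (h | h) (h' | h')
    · exact .inl (h.trans h')
    · exact .inr (mem_topologicalSupport_of_le h h')
    · exact .inr h
    · exact .inr h
  vle_add := by
    intro x y z hx hy
    by_cases hx' : x ∈ v.topologicalSupport
    · by_cases hy' : y ∈ v.topologicalSupport
      · exact .inr (add_mem_topologicalSupport hx' hy')
      · have := hy.resolve_right hy'
        exact .inl (v.map_add_le ((lt_of_mem_topologicalSupport hx' hy').le.trans this) this)
    · have := hx.resolve_right hx'
      by_cases hy' : y ∈ v.topologicalSupport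
      · exact .inl (v.map_add_le this ((lt_of_mem_topologicalSupport hy' hx').le.trans this))
      · exact .inl (v.map_add_le this (hy.resolve_right hy'))
  mul_vle_mul_left := by
    rintro x y (h | h) z
    · left; rw [map_mul, map_mul]; gcongr
    · exact .inr (mul_mem_topologicalSupport h z)
  vle_mul_cancel := by
    intro x y z hz h
    have hz' : z ∉ v.topologicalSupport := fun h' => hz (.inr h')
    rcases h with h | h
    · left
      rw [map_mul, map_mul] at h
      exact le_of_mul_le_mul_right h (zero_lt_iff.2 (ne_zero_of_notMem_topologicalSupport hz'))
    · exact .inr (by_contra fun hx => mul_notMem_topologicalSupport hI hx hz' h)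
  not_vle_one_zero := by
    rintro (h | h)
    · simp at h
    · exact one_notMem_topologicalSupport hI hv h
  vle_mul_comm {x y} := .inl (by rw [mul_comm]) }

end Pair

end Valuation

/-! ### Retraction onto the continuous valuations -/

namespace Spv

variable {A : Type*} [CommRing A]

theorem ext_val_le {v w : Spv A} (h : ∀ a b, v.val a ≤ v.val b ↔ w.val a ≤ w.val b) : v = w := by
  ext a b
  rw [← val_le_val_iff, ← val_le_val_iff, h]

instance : T0Space (Spv A) := by
  refine (t0Space_iff_inseparable _).2 fun v w h => ?_
  have hU : ∀ f s : A, (v.val f ≤ v.val s ∧ v.val s ≠ 0) ↔ (w.val f ≤ w.val s ∧ w.val s ≠ 0) :=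
    fun f s => h.mem_open_iff (s := {u : Spv A | u.val f ≤ u.val s ∧ u.val s ≠ 0})
      (isOpen_generateFrom_of_mem ⟨f, s, rfl⟩)
  have h0 : ∀ s : A, v.val s ≠ 0 ↔ w.val s ≠ 0 := fun s => by simpa using hU s s
  refine ext_val_le fun a b => ?_
  by_cases hb : v.val b = 0
  · have hb' : w.val b = 0 := by simpa [hb] using h0 b
    simpa [hb, hb'] using not_iff_not.1 (h0 a)
  · have hb' := (h0 b).1 hb
    simpa [hb, hb'] using hU a b

variable [TopologicalSpace A]

theorem isContinuous_iff [IsTopologicalRing A] {v : Spv A} :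
    v.IsContinuous ↔ ∀ a ∈ v.val.topologicalSupport, v.val a = 0 := by
  constructor
  · intro h a ha
    by_contra ha0
    exact ha ((h _ ha0).mem_nhds (by simpa using zero_lt_iff.2 ha0))
  · intro h γ hγ
    let := v.rel
    -- With `γ = v a / v b`, the condition `v x < γ` reads `v (x * b) < v a`, a neighbourhood of `0`
    -- by continuity of multiplication.
    obtain ⟨a, b, hab⟩ := ValuativeRel.exists_valuation_div_valuation_eq γ
    have hab : v.val a / v.val b = γ := hab
    have hb : v.val b ≠ 0 := by
      rintro hb
      simp [hb] at hab
      exact hγ hab.symm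
    have ha : v.val a ≠ 0 := by
      rintro ha
      simp [ha] at hab
      exact hγ hab.symm
    refine (v.val.ltAddSubgroup (Units.mk0 γ hγ)).isOpen_of_mem_nhds (g := 0) ?_
    refine Filter.mem_of_superset
      (Valuation.setOf_map_mul_lt_mem_nhds_zero (b : A) (mt (h a) ha)) fun x hx => ?_
    have hx : v.val (x * b) < v.val a := hx
    change v.val x < γ
    rwa [← hab, lt_div_iff₀ (zero_lt_iff.2 hb), ← map_mul]

theorem IsContinuous.map_lt_one {A₀ : Subring A} {I : Ideal A₀} {v : Spv A}
    (hI : IsPairOfDefinition A₀ I) (hc : v.IsContinuous)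
    {x : A₀} (hx : x ∈ I) : v.val x < 1 := by
  have hmem : {a : A | v.val a < 1} ∈ 𝓝 (0 : A) :=
    (hc 1 one_ne_zero).mem_nhds (by simp)
  obtain ⟨n, -, hn⟩ := hI.hasBasis_nhds_zero.mem_iff.1 hmem
  have := hn ⟨x ^ n, Ideal.pow_mem_pow hx n, rfl⟩
  by_contra h
  have h' : ¬ 1 ≤ v.val (x : A) ^ n := by simpa using this
  exact h' (one_le_pow₀ (not_lt.1 h))

/-! ### The retraction and its effect on rational conditions. -/

section Retract

variable [IsTopologicalRing A] {A₀ : Subring A} {I : Ideal A₀} (hI : IsPairOfDefinition A₀ I)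
  {v : Spv A} (hv : ∀ x ∈ I, v.val x < 1)

theorem retract_le_iff {a b : A} : (v.val.retract hI hv).val a ≤ (v.val.retract hI hv).val b ↔
    v.val a ≤ v.val b ∨ a ∈ v.val.topologicalSupport :=
  val_le_val_iff _ _ _

theorem retract_eq_zero_iff {a : A} :
    (v.val.retract hI hv).val a = 0 ↔ a ∈ v.val.topologicalSupport := by
  rw [← le_zero_iff, ← map_zero (v.val.retract hI hv).val, retract_le_iff, map_zero, le_zero_iff]
  exact or_iff_right_of_imp Valuation.mem_topologicalSupport_of_eq_zero

theorem isContinuous_retract : (v.val.retract hI hv).IsContinuous := by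
  refine isContinuous_iff.2 fun a ha => ?_
  rw [retract_eq_zero_iff]
  by_contra ha'
  refine ha (Filter.mem_of_superset (Valuation.notMem_topologicalSupport.1 ha') fun x hx => ?_)
  have hx : v.val x < v.val a := hx
  change (v.val.retract hI hv).val x < (v.val.retract hI hv).val a
  rw [← not_le, retract_le_iff]
  exact not_or.2 ⟨hx.not_ge, ha'⟩

theorem retract_eq_self (hc : v.IsContinuous) : v.val.retract hI hv = v := by
  refine ext_val_le fun a b => ?_
  rw [retract_le_iff]
  exact or_iff_left_of_imp fun ha => by simp [isContinuous_iff.1 hc a ha]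

theorem retract_mem_rational_iff {T : Set A} {s : A} (hT : IsOpen (Ideal.span T : Set A)) :
    ((∀ t ∈ T, (v.val.retract hI hv).val t ≤ (v.val.retract hI hv).val s) ∧
      (v.val.retract hI hv).val s ≠ 0) ↔ (∀ t ∈ T, v.val t ≤ v.val s) ∧ v.val s ≠ 0 := by
  simp only [retract_le_iff, ne_eq, retract_eq_zero_iff]
  constructor
  · rintro ⟨h, hs⟩
    exact ⟨fun t ht => (h t ht).elim id fun h' =>
      (Valuation.lt_of_mem_topologicalSupport h' hs).le,
      Valuation.ne_zero_of_notMem_topologicalSupport hs⟩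
  · rintro ⟨h, hs⟩
    refine ⟨fun t ht => .inl (h t ht), fun hs' => hs ?_⟩
    -- If `s` were in the topological support, convexity would put `T` and then its open span there,
    -- forcing `v s = 0`.
    have hspan : ∀ x ∈ Ideal.span T, x ∈ v.val.topologicalSupport := by
      intro x hx
      induction hx using Submodule.span_induction with
      | mem t ht => exact Valuation.mem_topologicalSupport_of_le (h t ht) hs'
      | zero => exact Valuation.mem_topologicalSupport_of_eq_zero (map_zero _)
      | add x y _ _ hx hy => exact Valuation.add_mem_topologicalSupport hx hy
      | smul c x _ hx =>
        rw [smul_eq_mul, mul_comm]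
        exact Valuation.mul_mem_topologicalSupport hx c
    obtain ⟨n, hn⟩ := (hI.isOpen_ideal_iff _).1 hT
    exact Valuation.eq_zero_of_pow_subset_topologicalSupport hI hv
      (fun x hx => hspan _ (hn x hx)) s hs'

end Retract

/-! ### Quasi-compactness of the constructible topology -/

section Constructible

variable {A : Type*} [CommRing A]

/-- The Boolean-valued relation on `A` of a point of the valuation spectrum. -/
def toBool (v : Spv A) : A → A → Bool := by
  classical exact fun a b => decide (v.val a ≤ v.val b)

theorem toBool_iff {v : Spv A} {a b : A} : v.toBool a b = true ↔ v.val a ≤ v.val b := by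
  simp [toBool]

theorem isClopen_setOf_apply {A : Type*} (a b : A) : IsClopen {f : A → A → Bool | f a b = true} :=
  (isClopen_discrete {true}).preimage (by fun_prop : Continuous fun f : A → A → Bool => f a b)

/-- Each valuation axiom constrains only finitely many values of the relation at a time, so it cuts
out an intersection of clopen sets. -/
theorem isClosed_range_toBool : IsClosed (Set.range (toBool : Spv A → A → A → Bool)) := by
  have ho := fun a b : A => (isClopen_setOf_apply a b).isOpen
  have hc := fun a b : A => (isClopen_setOf_apply a b).isClosed
  have hrange : Set.range (toBool : Spv A → A → A → Bool) =
      {f | (∀ x y, f x y = true ∨ f y x = true) ∧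
        (∀ z y x, f x y = true → f y z = true → f x z = true) ∧
        (∀ x y z, f x z = true → f y z = true → f (x + y) z = true) ∧
        (∀ x y z, f x y = true → f (x * z) (y * z) = true) ∧
        (∀ x y z, f z 0 = true ∨ (f (x * z) (y * z) = true → f x y = true)) ∧
        ¬ f 1 0 = true} := by
    ext f
    constructor
    · rintro ⟨v, rfl⟩
      simp only [Set.mem_ofPred_eq, toBool_iff, val_le_val_iff]
      let := v.rel
      exact ⟨v.rel.vle_total, fun _ _ _ => v.rel.vle_trans, fun _ _ _ => v.rel.vle_add,
        fun _ _ z h => v.rel.mul_vle_mul_left h z,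
        fun _ _ _ => or_iff_not_imp_left.2 v.rel.vle_mul_cancel, v.rel.not_vle_one_zero⟩
    · rintro ⟨h₁, h₂, h₃, h₄, h₅, h₆⟩
      refine ⟨⟨{
        vle := fun a b => f a b = true
        vle_total := h₁
        vle_trans := h₂ _ _ _
        vle_add := h₃ _ _ _
        mul_vle_mul_left := fun h z => h₄ _ _ z h
        vle_mul_cancel := fun hz => (h₅ _ _ _).resolve_left hz
        not_vle_one_zero := h₆
        vle_mul_comm := fun {x y} => by
          rw [mul_comm]
          -- Totality at a repeated argument is reflexivity.
          exact (h₁ _ _).elim id id }⟩, ?_⟩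
      ext a b
      rw [Bool.eq_iff_iff, toBool_iff, val_le_val_iff]
      rfl
  rw [hrange]
  refine .and ?_ (.and ?_ (.and ?_ (.and ?_ (.and ?_ (isClopen_setOf_apply 1 0).compl.isClosed))))
  · simp only [Set.ofPred_forall]
    exact isClosed_iInter fun x => isClosed_iInter fun y => (hc x y).union (hc y x)
  · simp only [Set.ofPred_forall]
    exact isClosed_iInter fun z => isClosed_iInter fun y => isClosed_iInter fun x =>
      isClosed_imp (ho x y) (isClosed_imp (ho y z) (hc x z))
  · simp only [Set.ofPred_forall]
    exact isClosed_iInter fun x => isClosed_iInter fun y => isClosed_iInter fun z =>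
      isClosed_imp (ho x z) (isClosed_imp (ho y z) (hc (x + y) z))
  · simp only [Set.ofPred_forall]
    exact isClosed_iInter fun x => isClosed_iInter fun y => isClosed_iInter fun z =>
      isClosed_imp (ho x y) (hc (x * z) (y * z))
  · simp only [Set.ofPred_forall]
    exact isClosed_iInter fun x => isClosed_iInter fun y => isClosed_iInter fun z =>
      (hc z 0).union (isClosed_imp (ho (x * z) (y * z)) (hc x y))

end Constructible

end Spv

open scoped Pointwise

/-! ### Rational subsets -/

section RationalSubsets

variable {A : Type*} [CommRing A] [TopologicalSpace A] {Aplus : Subring A}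

theorem mem_rationalSet {T : Finset A} {s : A} {v : Spa Aplus} :
    v ∈ rationalSet Aplus T s ↔ (∀ t ∈ T, v.1.val t ≤ v.1.val s) ∧ v.1.val s ≠ 0 := Iff.rfl

theorem isOpen_rationalSet (T : Finset A) (s : A) : IsOpen (rationalSet Aplus T s) := by
  classical
  have hU : ∀ t : A, IsOpen {v : Spa Aplus | v.1.val t ≤ v.1.val s ∧ v.1.val s ≠ 0} := fun t =>
    continuous_subtype_val.isOpen_preimage {v : Spv A | v.val t ≤ v.val s ∧ v.val s ≠ 0}
      (isOpen_generateFrom_of_mem ⟨t, s, rfl⟩)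
  convert isOpen_biInter_finset (s := insert s T) (fun t _ => hU t) using 1
  ext v
  simp only [mem_rationalSet, Set.mem_iInter, Finset.forall_mem_insert, Set.mem_ofPred_eq]
  exact ⟨fun h => ⟨⟨le_rfl, h.2⟩, fun t ht => ⟨h.1 t ht, h.2⟩⟩,
    fun h => ⟨fun t ht => (h.2 t ht).1, h.1.2⟩⟩

/-- Inserting `s` and `s'` puts the products `t * s'` and `s * t'` in the new numerator set;
cancelling there recovers the separate conditions. -/
theorem rationalSet_inter [DecidableEq A] (T T' : Finset A) (s s' : A) :
    rationalSet Aplus T s ∩ rationalSet Aplus T' s' =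
      rationalSet Aplus (insert s T * insert s' T') (s * s') := by
  ext v
  simp only [Set.mem_inter_iff, mem_rationalSet, Finset.mem_mul]
  constructor
  · rintro ⟨⟨hT, hs⟩, hT', hs'⟩
    refine ⟨?_, by simp [hs, hs']⟩
    rintro _ ⟨t, ht, t', ht', rfl⟩
    rw [map_mul, map_mul]
    have h₁ : v.1.val t ≤ v.1.val s := by
      rcases Finset.mem_insert.1 ht with rfl | ht
      exacts [le_rfl, hT t ht]
    have h₂ : v.1.val t' ≤ v.1.val s' := by
      rcases Finset.mem_insert.1 ht' with rfl | ht'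
      exacts [le_rfl, hT' t' ht']
    gcongr
  · rintro ⟨h, hss⟩
    rw [map_mul, mul_ne_zero_iff] at hss
    refine ⟨⟨fun t ht => ?_, hss.1⟩, fun t ht => ?_, hss.2⟩
    · have := h _ ⟨t, Finset.mem_insert_of_mem ht, s', Finset.mem_insert_self _ _, rfl⟩
      rw [map_mul, map_mul] at this
      exact le_of_mul_le_mul_right this (zero_lt_iff.2 hss.2)
    · have := h _ ⟨s, Finset.mem_insert_self _ _, t, Finset.mem_insert_of_mem ht, rfl⟩
      rw [map_mul, map_mul] at this
      exact le_of_mul_le_mul_left this (zero_lt_iff.2 hss.1)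

variable [IsTopologicalRing A] {A₀ : Subring A} {I : Ideal A₀} (hI : IsPairOfDefinition A₀ I)

include hI

theorem finiteInter_rationalSubsets : FiniteInter (rationalSubsets Aplus) where
  univ_mem := by
    refine ⟨{1}, 1, by simp, ?_⟩
    ext v
    simp [mem_rationalSet]
  inter_mem := by
    classical
    rintro _ ⟨T, s, hT, rfl⟩ _ ⟨T', s', hT', rfl⟩
    refine ⟨_, _, ?_, rationalSet_inter T T' s s'⟩
    rw [Finset.coe_mul, ← Ideal.span_mul_span']
    refine Submodule.isOpen_mono (Ideal.mul_mono ?_ ?_) (hI.isOpen_ideal_mul hT hT')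
    · exact Ideal.span_mono (by simp)
    · exact Ideal.span_mono (by simp)

/-- By continuity `v < v s` on some `I ^ n`. Adding generators of `I ^ n` to `f` makes the ideal
open while keeping `v` in the set. -/
theorem exists_rationalSubset_subset (v : Spa Aplus) {f s : A} (hf : v.1.val f ≤ v.1.val s)
    (hs : v.1.val s ≠ 0) : ∃ U ∈ rationalSubsets Aplus, v ∈ U ∧
      ∀ w ∈ U, w.1.val f ≤ w.1.val s ∧ w.1.val s ≠ 0 := by
  classical
  obtain ⟨n, -, hn⟩ := hI.hasBasis_nhds_zero.mem_iff.1
    ((v.2.1 _ hs).mem_nhds (show (0 : A) ∈ _ by simpa using zero_lt_iff.2 hs))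
  obtain ⟨S, hS⟩ := hI.fg.pow (n := n)
  refine ⟨_, ⟨insert f (S.image Subtype.val), s, ?_, rfl⟩, ⟨?_, hs⟩, fun w hw =>
    ⟨hw.1 f (Finset.mem_insert_self _ _), hw.2⟩⟩
  · refine (hI.isOpen_ideal_iff _).2 ⟨n, fun x hx => ?_⟩
    rw [← hS] at hx
    have := Ideal.mem_map_of_mem A₀.subtype hx
    rw [Ideal.map_span] at this
    refine Ideal.span_mono ?_ this
    simp
  · simp only [Finset.forall_mem_insert, Finset.forall_mem_image]
    exact ⟨hf, fun x hx => (hn ⟨x, hS ▸ Ideal.subset_span hx, rfl⟩).le⟩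

theorem isTopologicalBasis_rationalSubsets : IsTopologicalBasis (rationalSubsets Aplus) := by
  refine isTopologicalBasis_of_subbasis_of_finiteInter ?_ (finiteInter_rationalSubsets hI)
  refine le_antisymm (le_generateFrom ?_) ?_
  · rintro _ ⟨T, s, -, rfl⟩
    exact isOpen_rationalSet T s
  · refine continuous_iff_le_induced.1 (continuous_generateFrom_iff.2 ?_)
    rintro _ ⟨f, s, rfl⟩
    let := generateFrom (rationalSubsets Aplus)
    refine isOpen_iff_forall_mem_open.2 fun v hv => ?_
    obtain ⟨U, hU, hvU, h⟩ := exists_rationalSubset_subset hI v hv.1 hv.2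
    exact ⟨U, h, isOpen_generateFrom_of_mem hU, hvU⟩

/-- The adic spectrum is the image of a quasi-compact space under a map for which the preimages
of the rational subsets are open and closed. -/
theorem exists_isClopen_preimage_rationalSubsets :
    ∃ (K : Set (A → A → Bool)) (g : K → Spa Aplus), IsCompact K ∧ Function.Surjective g ∧
      ∀ U ∈ rationalSubsets Aplus, IsClopen (g ⁻¹' U) := by
  -- Points of `P` need not be continuous: continuity is not a closed condition on relations,
  -- whereas these two are.
  let P : Set (Spv A) := {v | (∀ f ∈ Aplus, v.val f ≤ 1) ∧ ∀ x ∈ I, v.val x < 1}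
  have hK : IsClosed (Spv.toBool '' P) := by
    have : Spv.toBool '' P = Set.range Spv.toBool ∩
        ((⋂ f ∈ Aplus, {r | r f 1 = true}) ∩ ⋂ x ∈ I, {r | r 1 (x : A) = true}ᶜ) := by
      ext r
      constructor
      · rintro ⟨v, hv, rfl⟩
        simpa [Spv.toBool_iff, P] using hv
      · rintro ⟨⟨v, rfl⟩, hv⟩
        exact ⟨v, by simpa [Spv.toBool_iff, P] using hv, rfl⟩
    rw [this]
    exact Spv.isClosed_range_toBool.inter
      ((isClosed_biInter fun f _ => (Spv.isClopen_setOf_apply f 1).isClosed).inter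
        (isClosed_biInter fun x _ => (Spv.isClopen_setOf_apply 1 (x : A)).compl.isClosed))
  choose v hvP hv using fun k : Spv.toBool '' P => k.2
  let g : Spv.toBool '' P → Spa Aplus := fun k => ⟨(v k).val.retract hI (hvP k).2,
    Spv.isContinuous_retract hI (hvP k).2, fun f hf => by
      rw [← map_one ((v k).val.retract hI (hvP k).2).val, Spv.retract_le_iff, map_one]
      exact .inl ((hvP k).1 f hf)⟩
  refine ⟨_, g, hK.isCompact, fun w => ?_, ?_⟩
  · have hw : w.1 ∈ P := ⟨w.2.2, fun x hx => w.2.1.map_lt_one hI hx⟩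
    refine ⟨⟨_, w.1, hw, rfl⟩, Subtype.ext ?_⟩
    have : v ⟨_, w.1, hw, rfl⟩ = w.1 := Spv.ext_val_le fun a b => by
      rw [← Spv.toBool_iff, hv, Spv.toBool_iff]
    exact (Spv.retract_eq_self hI (hvP _).2
      (this.symm.subst (motive := Spv.IsContinuous) w.2.1)).trans this
  · rintro _ ⟨T, s, hT, rfl⟩
    -- The conditions can be tested on `v k` before retraction, where they involve only the
    -- coordinates `(t, s)` and `(s, 0)`.
    have : g ⁻¹' rationalSet Aplus T s = Subtype.val ⁻¹'
        ((⋂ t ∈ T, {r : A → A → Bool | r t s = true}) ∩ {r | r s 0 = true}ᶜ) := by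
      ext k
      refine (Spv.retract_mem_rational_iff hI (hvP k).2 hT).trans ?_
      simp only [Set.mem_preimage, Set.mem_inter_iff, Set.mem_iInter, Set.mem_ofPred_eq,
        Set.mem_compl_iff, ← hv k, Spv.toBool_iff, map_zero, le_zero_iff, Finset.mem_coe]
    rw [this]
    exact ((isClopen_biInter_finset fun t _ => Spv.isClopen_setOf_apply t s).inter
      (Spv.isClopen_setOf_apply s 0).compl).preimage continuous_subtype_val

end RationalSubsets

end

theorem mainTheorem1 {A : Type*} [CommRing A] [TopologicalSpace A] (Aplus : Subring A)
    (hA : IsAffinoidRing Aplus) :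
    SpectralSpace (Spa Aplus) ∧
      (IsTopologicalBasis (rationalSubsets Aplus) ∧
        (∀ U ∈ rationalSubsets Aplus, IsOpen U ∧ IsCompact U) ∧
        FiniteInter (rationalSubsets Aplus)) := by
  have := hA.isFAdicRing.isTopologicalRing
  obtain ⟨A₀, I, hI⟩ := hA.isFAdicRing.exists_pairOfDefinition
  have hB := isTopologicalBasis_rationalSubsets (Aplus := Aplus) hI
  have hinter := finiteInter_rationalSubsets (Aplus := Aplus) hI
  obtain ⟨K, g, hK, hg, hclopen⟩ := exists_isClopen_preimage_rationalSubsets (Aplus := Aplus) hI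
  have := isCompact_iff_compactSpace.1 hK
  exact ⟨spectralSpace_of_isClopen_preimage hB hinter hg hclopen, hB,
    fun U hU => ⟨hB.isOpen hU, isCompact_of_isClopen_preimage hB hg hclopen hU⟩, hinter⟩
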